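/- Let $\alpha\ge 1/2$ and $\lambda>0$, and let $\gamma_{\alpha,\lambda}$ be the gamma law on $(0,\infty)$ with density $\frac{\lambda^{\alpha}}{\Gamma(\alpha)}u^{\alpha-1}e^{-\lambda u}$. Let $X$ be a random variable with values in $(0,\infty)$ almost surely whose law has a Lebesgue density $f_X\ge 0$ that is differentiable on $(0,\infty)$. Write $\rho_X(u)=\partial_u\log f_X(u)$ for its score (defined where $f_X>0$, hence at almost every value of $X$), and let $$J_{st,\gamma}(X)=\mathbb{E}\Big[X\Big(\rho_X(X)-\frac{\alpha-1}{X}+\lambda\Big)^2\Big]\in[0,\infty]$$ be the standardized Fisher information of $X$ relative to $\gamma_{\alpha,\lambda}$. If $J_{st,\gamma}(X)<\infty$, then the relative entropy $D(X\|\gamma_{\alpha,\lambda})$ of the law of $X$ with respect to $\gamma_{\alpha,\lambda}$ is finite and satisfies the logarithmic Sobolev inequality $$D(X\|\gamma_{\alpha,\lambda})\le\frac1\lambda\,J_{st,\gamma}(X).$$ -/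

import Mathlib

open MeasureTheory Set

noncomputable section

/-- The classical score `ρ_f(u) = ∂_u log f(u)` of a density `f`. -/
def score (f : ℝ → ℝ) (u : ℝ) : ℝ :=
  deriv (fun v => Real.log (f v)) u

/-- The score `(α - 1) / u - lam` of the gamma law with shape `α` and rate `lam`, for `u > 0`. -/
def gammaScore (α lam u : ℝ) : ℝ :=
  (α - 1) / u - lam

/-- The standardized Fisher information `E[X (ρ_X(X) - ρ_{α,lam}(X))²] ∈ [0, ∞]` of a positive
random variable `X` with density `f`, relative to the gamma law with shape `α` and rate `lam`.
Only points where `f > 0` matter, since `f(X) > 0` almost surely. -/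
def stdGammaFisher {Ω : Type*} [MeasurableSpace Ω] (P : Measure Ω) (X : Ω → ℝ) (f : ℝ → ℝ)
    (α lam : ℝ) : ENNReal :=
  ∫⁻ ω, ENNReal.ofReal (X ω * (score f (X ω) - gammaScore α lam (X ω)) ^ 2) ∂P

end

/-! The proof is by mass transport. Let `p` be the gamma density and `T` the increasing map pushing
`f` to `p`, so that `p (T x) * T' x = f x`. Taking logarithms and using `log y ≤ y - 1` bounds `f
log (f / p)` by the derivative of `2 f (√(x T) - x)` plus `x (f' - s f)² / (lam f)`, with `s` the
gamma score: the gap left after the logarithm bounds is a perfect square (`entropy_density_le`). The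
geometric mean `√(x T)` suits the weight `x` in the Fisher information, and `α ≥ 1/2` makes the
coefficient `2α - 1` of the logarithm nonnegative.

Integrating over `[a, b]` leaves boundary terms. They become small along suitable `a → 0`, `b → ∞`,
because `f` and `T f` are integrable at infinity and `1/x` is not (`exists_interval_entropy_le`). A
density with zeros is first mixed with `p`, which does not increase the information; Fatou's lemma
then removes the mixture (`lintegral_klFun_le`). -/

section GammaLogSobolev

open Filter Topology

variable {α lam : ℝ}

/-! ### Monotone transport on the half-line. -/

/-- The primitive from `0` of a density on `(0, ∞)` is differentiable, with derivative the
density. -/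
lemma hasDerivAt_primitive_of_continuousOn_Ioi {q : ℝ → ℝ} (hc : ContinuousOn q (Ioi 0))
    (hi : IntegrableOn q (Ioi 0)) {x : ℝ} (hx : 0 < x) :
    HasDerivAt (fun y => ∫ u in (0 : ℝ)..y, q u) (q x) x := by
  apply intervalIntegral.integral_hasDerivAt_right
  · rw [intervalIntegrable_iff_integrableOn_Ioc_of_le hx.le]
    exact hi.mono_set Ioc_subset_Ioi_self
  · exact hc.stronglyMeasurableAtFilter isOpen_Ioi x hx
  · exact hc.continuousAt (Ioi_mem_nhds hx)

lemma strictMonoOn_primitive_of_pos {q : ℝ → ℝ} (hc : ContinuousOn q (Ioi 0))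
    (hi : IntegrableOn q (Ioi 0)) (hpos : ∀ x, 0 < x → 0 < q x) :
    StrictMonoOn (fun y => ∫ u in (0 : ℝ)..y, q u) (Ioi 0) := by
  have hd := fun x hx => hasDerivAt_primitive_of_continuousOn_Ioi hc hi (x := x) hx
  refine strictMonoOn_of_deriv_pos (convex_Ioi 0)
    (fun x hx => (hd x hx).continuousAt.continuousWithinAt) fun x hx => ?_
  rw [interior_Ioi] at hx
  rw [(hd x hx).deriv]
  exact hpos x hx

/-- The primitive from `0` of a positive continuous probability density on `(0, ∞)` maps `(0, ∞)`
into `(0, 1)`. -/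
lemma mapsTo_primitive_of_pos {q : ℝ → ℝ} (hc : ContinuousOn q (Ioi 0))
    (hi : IntegrableOn q (Ioi 0)) (hpos : ∀ x, 0 < x → 0 < q x)
    (hone : ∫ u in Ioi (0 : ℝ), q u = 1) :
    MapsTo (fun y => ∫ u in (0 : ℝ)..y, q u) (Ioi 0) (Ioo 0 1) := by
  intro x hx
  have hx : 0 < x := hx
  constructor
  · apply intervalIntegral.intervalIntegral_pos_of_pos_on _ (fun u hu => hpos u hu.1) hx
    rw [intervalIntegrable_iff_integrableOn_Ioc_of_le hx.le]
    exact hi.mono_set Ioc_subset_Ioi_self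
  · have h1 := strictMonoOn_primitive_of_pos hc hi hpos hx
      (show (0 : ℝ) < x + 1 by linarith) (by linarith)
    refine h1.trans_le ?_
    simp only [intervalIntegral.integral_of_le (show 0 ≤ x + 1 by linarith)]
    refine le_of_le_of_eq ?_ hone
    exact setIntegral_mono_set hi
      ((ae_restrict_iff' measurableSet_Ioi).2 (ae_of_all _ fun u hu => (hpos u hu).le))
      Ioc_subset_Ioi_self.eventuallyLE

/-- The primitive from `0` of a continuous probability density on `(0, ∞)` takes every
value in `(0, 1)`. -/
lemma surjOn_primitive {q : ℝ → ℝ} (hc : ContinuousOn q (Ioi 0))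
    (hi : IntegrableOn q (Ioi 0)) (hone : ∫ u in Ioi (0 : ℝ), q u = 1) :
    SurjOn (fun y => ∫ u in (0 : ℝ)..y, q u) (Ioi 0) (Ioo 0 1) := by
  have hd := fun x hx => hasDerivAt_primitive_of_continuousOn_Ioi hc hi (x := x) hx
  rintro c ⟨hc0, hc1⟩
  have htop : Tendsto (fun y => ∫ u in (0 : ℝ)..y, q u) atTop (𝓝 1) := by
    rw [← hone]
    exact intervalIntegral_tendsto_integral_Ioi 0 hi tendsto_id
  have hzero : Tendsto (fun y => ∫ u in (0 : ℝ)..y, q u) (𝓝[>] 0) (𝓝 0) := by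
    have hcont : ContinuousOn (fun y => ∫ u in (0 : ℝ)..y, q u) (Icc 0 1) := by
      rw [← uIcc_of_le zero_le_one]
      apply intervalIntegral.continuousOn_primitive_interval
      rw [uIcc_of_le zero_le_one, integrableOn_Icc_iff_integrableOn_Ioc]
      exact hi.mono_set Ioc_subset_Ioi_self
    have := (hcont 0 (by simp)).tendsto
    simp only [intervalIntegral.integral_same] at this
    refine this.mono_left ?_
    rw [← nhdsWithin_Ioc_eq_nhdsGT zero_lt_one]
    exact nhdsWithin_mono _ Ioc_subset_Icc_self
  obtain ⟨a, ha, ha0⟩ :=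
    ((hzero.eventually (gt_mem_nhds hc0)).and self_mem_nhdsWithin).exists
  obtain ⟨b, hb, hab⟩ :=
    ((htop.eventually (lt_mem_nhds hc1)).and (eventually_ge_atTop a)).exists
  have ha0 : 0 < a := ha0
  obtain ⟨y, hy, hyc⟩ := intermediate_value_Icc hab
    (fun x hx => (hd x (ha0.trans_le hx.1)).continuousAt.continuousWithinAt) ⟨ha.le, hb.le⟩
  exact ⟨y, ha0.trans_le hy.1, hyc⟩

/-- The monotone transport map between two positive continuous probability densities on `(0, ∞)`
exists and solves the Monge–Ampère equation `p (T x) * T' x = f x`. -/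
lemma exists_transport {f p : ℝ → ℝ} (hfc : ContinuousOn f (Ioi 0)) (hfi : IntegrableOn f (Ioi 0))
    (hfpos : ∀ x, 0 < x → 0 < f x) (hf1 : ∫ u in Ioi (0 : ℝ), f u = 1)
    (hpc : ContinuousOn p (Ioi 0)) (hpi : IntegrableOn p (Ioi 0))
    (hppos : ∀ x, 0 < x → 0 < p x) (hp1 : ∫ u in Ioi (0 : ℝ), p u = 1) :
    ∃ T : ℝ → ℝ, ∀ x, 0 < x → 0 < T x ∧ HasDerivAt T (f x / p (T x)) x := by
  set F : ℝ → ℝ := fun y => ∫ u in (0 : ℝ)..y, f u with hF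
  set G : ℝ → ℝ := fun y => ∫ u in (0 : ℝ)..y, p u with hG
  have hFm : StrictMonoOn F (Ioi 0) := strictMonoOn_primitive_of_pos hfc hfi hfpos
  have hGm : StrictMonoOn G (Ioi 0) := strictMonoOn_primitive_of_pos hpc hpi hppos
  have hFmaps : MapsTo F (Ioi 0) (Ioo 0 1) := mapsTo_primitive_of_pos hfc hfi hfpos hf1
  have hGmaps : MapsTo G (Ioi 0) (Ioo 0 1) := mapsTo_primitive_of_pos hpc hpi hppos hp1
  have hFsurj : SurjOn F (Ioi 0) (Ioo 0 1) := surjOn_primitive hfc hfi hf1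
  have hGsurj : SurjOn G (Ioi 0) (Ioo 0 1) := surjOn_primitive hpc hpi hp1
  have hex : ∀ x : ℝ, ∃ t, 0 < x → 0 < t ∧ G t = F x := fun x => by
    by_cases hx : 0 < x
    · obtain ⟨t, ht, h⟩ := hGsurj (hFmaps hx)
      exact ⟨t, fun _ => ⟨ht, h⟩⟩
    · exact ⟨0, fun h => absurd h hx⟩
  -- `T = G⁻¹ ∘ F` on the half-line.
  choose T hT using hex
  have hTm : MonotoneOn T (Ioi 0) := fun x hx y hy hxy => by
    rw [← hGm.le_iff_le (hT x hx).1 (hT y hy).1, (hT x hx).2, (hT y hy).2]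
    exact hFm.monotoneOn hx hy hxy
  have himg : Ioi 0 ⊆ T '' Ioi 0 := fun t ht => by
    obtain ⟨x, hx, h⟩ := hFsurj (hGmaps ht)
    exact ⟨x, hx, hGm.injOn (hT x hx).1 ht ((hT x hx).2.trans h)⟩
  have hTc : ∀ x, 0 < x → ContinuousAt T x := fun x hx =>
    continuousAt_of_monotoneOn_of_image_mem_nhds hTm (Ioi_mem_nhds hx)
      (mem_of_superset (Ioi_mem_nhds (hT x hx).1) himg)
  refine ⟨T, fun x hx => ⟨(hT x hx).1, ?_⟩⟩
  have hTx := (hT x hx).1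
  have hdG := hasDerivAt_primitive_of_continuousOn_Ioi hpc hpi hTx
  have hdF := hasDerivAt_primitive_of_continuousOn_Ioi hfc hfi hx
  -- Since `G ∘ T = F`, the slope of `T` is the slope of `F` divided by that of `G` along `T`.
  have hslope : Tendsto (slope T x) (𝓝[≠] x) (𝓝 (f x / p (T x))) := by
    have h1 : Tendsto (slope F x) (𝓝[≠] x) (𝓝 (f x)) := hasDerivAt_iff_tendsto_slope.1 hdF
    have hne : ∀ᶠ y in 𝓝[≠] x, 0 < y ∧ T y ≠ T x := by
      filter_upwards [self_mem_nhdsWithin, mem_nhdsWithin_of_mem_nhds (Ioi_mem_nhds hx)]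
        with y hy hy0
      refine ⟨hy0, fun h => hy (hFm.injOn hy0 hx ?_)⟩
      rw [← (hT y hy0).2, ← (hT x hx).2, h]
    have h2 : Tendsto (fun y => slope G (T x) (T y)) (𝓝[≠] x) (𝓝 (p (T x))) := by
      refine (hasDerivAt_iff_tendsto_slope.1 hdG).comp
        (tendsto_nhdsWithin_of_tendsto_nhds_of_eventually_within _
          ((hTc x hx).tendsto.mono_left nhdsWithin_le_nhds) ?_)
      filter_upwards [hne] with y hy using hy.2
    refine (h1.div h2 (hppos _ hTx).ne').congr' ?_
    filter_upwards [hne, self_mem_nhdsWithin] with y hy hyx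
    have hGne : G (T y) - G (T x) ≠ 0 := fun h =>
      hy.2 (hGm.injOn (hT y hy.1).1 hTx (sub_eq_zero.1 h))
    have hyx' : y - x ≠ 0 := sub_ne_zero.2 hyx
    have hTyx : T y - T x ≠ 0 := sub_ne_zero.2 hy.2
    simp only [Pi.div_apply, slope_def_field]
    rw [← (hT y hy.1).2, ← (hT x hx).2]
    field_simp
  exact hasDerivAt_iff_tendsto_slope.2 hslope

/-! ### Points where boundary terms are small. -/

/-- If `g` is integrable at infinity, then `x * g x` takes arbitrarily small values there. -/
lemma exists_gt_mul_lt_of_integrableOn_Ioi {g : ℝ → ℝ} {N : ℝ} (hg : IntegrableOn g (Ioi N))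
    (hN : 0 < N) {ε : ℝ} (hε : 0 < ε) : ∃ b, N < b ∧ b * g b < ε := by
  by_contra! h
  -- Otherwise `g x ≥ ε / x` throughout, which would make `1/x` integrable at infinity.
  refine not_integrableOn_Ioi_inv (a := N) ?_
  have hgN := hg.const_mul ε⁻¹
  refine hgN.mono' measurable_inv.aestronglyMeasurable
    ((ae_restrict_iff' measurableSet_Ioi).2 (ae_of_all _ fun x hx => ?_))
  have hx0 : 0 < x := hN.trans hx
  have := h x hx
  rw [Real.norm_of_nonneg (by positivity), inv_mul_eq_div, le_div_iff₀ hε, inv_mul_le_iff₀ hx0]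
  exact this

/-- If `g` is integrable at zero, then `x * g x` takes arbitrarily small values there. -/
lemma exists_lt_mul_lt_of_integrableOn_Ioi {g : ℝ → ℝ} (hg : IntegrableOn g (Ioi 0))
    {ε : ℝ} (hε : 0 < ε) {δ : ℝ} (hδ : 0 < δ) : ∃ a, 0 < a ∧ a < δ ∧ a * g a < ε := by
  by_contra! h
  have hno : ¬ IntervalIntegrable (fun x : ℝ => x⁻¹) volume 0 δ := by
    simp [intervalIntegrable_inv_iff, hδ.ne, hδ.le]
  refine hno ?_
  rw [intervalIntegrable_iff_integrableOn_Ioo_of_le hδ.le]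
  have hgN := (hg.mono_set (Ioo_subset_Ioi_self : Ioo 0 δ ⊆ _)).const_mul ε⁻¹
  refine hgN.mono' measurable_inv.aestronglyMeasurable
    ((ae_restrict_iff' measurableSet_Ioo).2 (ae_of_all _ fun x hx => ?_))
  have hx0 : 0 < x := hx.1
  have := h x hx0 hx.2
  rw [Real.norm_of_nonneg (by positivity), inv_mul_eq_div, le_div_iff₀ hε, inv_mul_le_iff₀ hx0]
  exact this

/-! ### The gamma density. -/

lemma hasDerivAt_gammaPDFReal (α lam : ℝ) {x : ℝ} (hx : 0 < x) :
    HasDerivAt (ProbabilityTheory.gammaPDFReal α lam)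
      (gammaScore α lam x * ProbabilityTheory.gammaPDFReal α lam x) x := by
  have h1 := (((Real.hasDerivAt_rpow_const (p := α - 1) (Or.inl hx.ne')).mul
    ((((hasDerivAt_id x).const_mul lam).neg).exp)).const_mul (lam ^ α / Real.Gamma α))
  refine (h1.congr_of_eventuallyEq ?_).congr_deriv ?_
  · filter_upwards [Ioi_mem_nhds hx] with y hy
    have hy : 0 < y := hy
    simp [ProbabilityTheory.gammaPDFReal, hy.le, mul_assoc]
  · simp only [ProbabilityTheory.gammaPDFReal, if_pos hx.le, gammaScore, id, Pi.neg_apply]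
    rw [Real.rpow_sub_one hx.ne' (α - 1)]
    field_simp
    ring

lemma log_gammaPDFReal {α lam : ℝ} (hα : 0 < α) (hlam : 0 < lam) {x : ℝ} (hx : 0 < x) :
    Real.log (ProbabilityTheory.gammaPDFReal α lam x) =
      Real.log (lam ^ α / Real.Gamma α) + (α - 1) * Real.log x - lam * x := by
  have hG := Real.Gamma_pos_of_pos hα
  rw [ProbabilityTheory.gammaPDFReal, if_pos hx.le, Real.log_mul (by positivity) (by positivity),
    Real.log_mul (by positivity) (by positivity), Real.log_exp, Real.log_rpow hx]
  ring

lemma integrableOn_gammaPDFReal {α lam : ℝ} (hα : 0 < α) (hlam : 0 < lam) :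
    IntegrableOn (ProbabilityTheory.gammaPDFReal α lam) (Ioi 0) := by
  have h := ProbabilityTheory.lintegral_gammaPDF_eq_one hα hlam
  refine Integrable.integrableOn ⟨by fun_prop, ?_⟩
  rw [hasFiniteIntegral_iff_ofReal
    (ae_of_all _ (ProbabilityTheory.gammaPDFReal_nonneg hα hlam))]
  exact h.trans_lt ENNReal.one_lt_top

lemma integral_gammaPDFReal {α lam : ℝ} (hα : 0 < α) (hlam : 0 < lam) :
    ∫ x in Ioi (0 : ℝ), ProbabilityTheory.gammaPDFReal α lam x = 1 := by
  have h := ProbabilityTheory.lintegral_gammaPDF_eq_one hα hlam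
  rw [← integral_Ici_eq_integral_Ioi, setIntegral_eq_integral_of_forall_compl_eq_zero,
    integral_eq_lintegral_of_nonneg_ae
      (ae_of_all _ (ProbabilityTheory.gammaPDFReal_nonneg hα hlam)) (by fun_prop)]
  · exact (congrArg ENNReal.toReal h).trans ENNReal.toReal_one
  · intro x hx
    exact if_neg hx

lemma integrableOn_id_mul_gammaPDFReal {α lam : ℝ} (hα : 0 < α) (hlam : 0 < lam) :
    IntegrableOn (fun x => x * ProbabilityTheory.gammaPDFReal α lam x) (Ioi 0) := by
  -- The factor `x` raises the shape by one, and `Γ(α + 1) = α Γ(α)` gives the constant `α / lam`.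
  refine IntegrableOn.congr_fun
    (f := fun x => (α / lam) * ProbabilityTheory.gammaPDFReal (α + 1) lam x)
    ((integrableOn_gammaPDFReal (by linarith) hlam).const_mul _) (fun x hx => ?_) measurableSet_Ioi
  have hx : 0 < x := hx
  have hG := Real.Gamma_pos_of_pos hα
  simp only [ProbabilityTheory.gammaPDFReal, if_pos hx.le]
  rw [Real.Gamma_add_one hα.ne', Real.rpow_add_one hlam.ne', add_sub_cancel_right,
    Real.rpow_sub_one hx.ne']
  field_simp

/-! ### The transport inequality, pointwise and integrated. -/

/-- The pointwise inequality behind the transport proof: with `t` the image of `x` under the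
transport map and `w = √(x t) - x`, the entropy density is at most a derivative plus the
information density. -/
lemma entropy_density_le {α lam x t f D : ℝ} (hα : 1 / 2 ≤ α) (hlam : 0 < lam) (hx : 0 < x)
    (ht : 0 < t) (hf : 0 < f) :
    f * Real.log (f / ProbabilityTheory.gammaPDFReal α lam x) ≤
      2 * (D * (√(x * t) - x) + f * ((t + x * (f / ProbabilityTheory.gammaPDFReal α lam t)) /
        (2 * √(x * t)) - 1)) + x * (D - gammaScore α lam x * f) ^ 2 / f / lam := by
  have hα0 : 0 < α := by linarith
  have hpx := ProbabilityTheory.gammaPDFReal_pos hα0 hlam hx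
  have hpt := ProbabilityTheory.gammaPDFReal_pos hα0 hlam ht
  have hlx := log_gammaPDFReal hα0 hlam hx
  have hlt := log_gammaPDFReal hα0 hlam ht
  rw [Real.log_div hf.ne' hpx.ne', hlx]
  set q := ProbabilityTheory.gammaPDFReal α lam t
  -- With `r = √(t / x)` the square root disappears: `√(x t) = x r`.
  obtain ⟨r, hr, rfl⟩ : ∃ r, 0 < r ∧ t = x * r ^ 2 :=
    ⟨√(t / x), by positivity, by rw [Real.sq_sqrt (by positivity)]; field_simp⟩
  have hs : √(x * (x * r ^ 2)) = x * r := by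
    rw [show x * (x * r ^ 2) = (x * r) ^ 2 by ring, Real.sqrt_sq (by positivity)]
  rw [hs]
  -- `σ r` is the derivative `f / q` of the transport map; splitting off `r` leaves `log r` with
  -- total coefficient `2α - 1`.
  obtain ⟨σ, hσ, hfq⟩ : ∃ σ, 0 < σ ∧ f = q * (σ * r) :=
    ⟨f / q / r, by positivity, by field_simp⟩
  have hlf : Real.log f = Real.log q + (Real.log σ + Real.log r) := by
    rw [hfq, Real.log_mul (by positivity) (by positivity),
      Real.log_mul (by positivity) (by positivity)]
  rw [Real.log_mul hx.ne' (by positivity), Real.log_pow] at hlt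
  have hdiv : f / q = σ * r := by rw [hfq]; field_simp
  rw [hdiv]
  have h1 : Real.log σ ≤ σ - 1 := Real.log_le_sub_one_of_pos hσ
  have h2 : Real.log r ≤ r - 1 := Real.log_le_sub_one_of_pos hr
  have h3 : (2 * α - 1) * Real.log r ≤ (2 * α - 1) * (r - 1) :=
    mul_le_mul_of_nonneg_left h2 (by linarith)
  have h4 : Real.log f - (Real.log (lam ^ α / Real.Gamma α) + (α - 1) * Real.log x - lam * x) ≤
      (σ - 1) + (2 * α - 1) * (r - 1) - lam * x * (r ^ 2 - 1) := by
    rw [hlf, hlt]; push_cast; linarith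
  refine (mul_le_mul_of_nonneg_left h4 hf.le).trans ?_
  -- This square is exactly the difference of the two sides.
  have h5 : 0 ≤ x * ((D - gammaScore α lam x * f) + lam * f * (r - 1)) ^ 2 / f / lam := by
    positivity
  have h6 : (x * r ^ 2 + x * (σ * r)) / (2 * (x * r)) = (r + σ) / 2 := by field_simp
  rw [h6]
  refine sub_nonneg.1 (h5.trans_eq ?_)
  simp only [gammaScore]
  field_simp
  ring

lemma continuousOn_gammaPDFReal (α lam : ℝ) :
    ContinuousOn (ProbabilityTheory.gammaPDFReal α lam) (Ioi 0) := fun _ hx =>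
  (hasDerivAt_gammaPDFReal α lam hx).continuousAt.continuousWithinAt

/-- If `T` transports the density `f` to the density `p` and `p` has a first moment, then `T` is
`f`-integrable at infinity. -/
lemma integrableOn_mul_transport {f p T : ℝ → ℝ} (hfc : ContinuousOn f (Ioi 0))
    (hf : ∀ x, 0 < x → 0 ≤ f x) (hpc : ContinuousOn p (Ioi 0)) (hp : ∀ x, 0 < x → 0 < p x)
    (hpm : IntegrableOn (fun x => x * p x) (Ioi 0))
    (hT : ∀ x, 0 < x → 0 < T x ∧ HasDerivAt T (f x / p (T x)) x) {N : ℝ} (hN : 0 < N) :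
    IntegrableOn (fun x => T x * f x) (Ioi N) := by
  have hTc : ContinuousOn T (Ioi 0) := fun x hx => (hT x hx).2.continuousAt.continuousWithinAt
  have hmc : ContinuousOn (fun x => x * p x) (Ioi 0) := continuousOn_id.mul hpc
  have hmpos : ∀ x, 0 < x → 0 < x * p x := fun x hx => mul_pos hx (hp x hx)
  have hcont : ContinuousOn (fun x => T x * f x) (Ioi 0) := hTc.mul hfc
  refine integrableOn_Ioi_of_intervalIntegral_norm_bounded (∫ u in Ioi (0 : ℝ), u * p u) N
    (b := id) (l := atTop) (fun b => ?_) tendsto_id ?_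
  · refine IntegrableOn.mono_set (t := Icc N b) ?_ Ioc_subset_Icc_self
    exact (hcont.mono fun x hx => hN.trans_le hx.1).integrableOn_Icc
  · filter_upwards [eventually_ge_atTop N] with b hb
    -- Change of variables: `T f` is the derivative of `∫₀^{T x} u p(u) du`, which never exceeds the
    -- mean of `p`.
    have hd : ∀ x ∈ uIcc N b, HasDerivAt
        ((fun y => ∫ u in (0 : ℝ)..y, u * p u) ∘ T) (T x * f x) x := fun x hx => by
      rw [uIcc_of_le hb] at hx
      have hx0 := hN.trans_le hx.1
      refine ((hasDerivAt_primitive_of_continuousOn_Ioi hmc hpm (hT x hx0).1).comp x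
        (hT x hx0).2).congr_deriv ?_
      have := (hp _ (hT x hx0).1).ne'
      field_simp
    have hint : IntervalIntegrable (fun x => T x * f x) volume N b := by
      refine (hcont.mono fun x hx => ?_).intervalIntegrable
      rw [uIcc_of_le hb] at hx
      exact hN.trans_le hx.1
    have heq : ∫ x in N..b, ‖T x * f x‖ = ∫ x in N..b, T x * f x := by
      refine intervalIntegral.integral_congr fun x hx => ?_
      rw [uIcc_of_le hb] at hx
      have hx0 := hN.trans_le hx.1
      exact Real.norm_of_nonneg (mul_nonneg (hT x hx0).1.le (hf x hx0))
    rw [id, heq, intervalIntegral.integral_eq_sub_of_hasDerivAt hd hint]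
    have hb0 := (hT b (hN.trans_le hb)).1
    have hnn := (ae_restrict_iff' (μ := volume) measurableSet_Ioi).2
      (ae_of_all _ fun u (hu : u ∈ Ioi (0 : ℝ)) => (hmpos u hu).le)
    have h1 : ∫ u in (0 : ℝ)..T b, u * p u ≤ ∫ u in Ioi (0 : ℝ), u * p u := by
      rw [intervalIntegral.integral_of_le hb0.le]
      exact setIntegral_mono_set hpm hnn Ioc_subset_Ioi_self.eventuallyLE
    have h2 : 0 ≤ ∫ u in (0 : ℝ)..T N, u * p u :=
      intervalIntegral.integral_nonneg (hT N hN).1.le fun u hu => by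
        rcases hu.1.eq_or_lt with rfl | h
        · simp
        · exact (hmpos u h).le
    simp only [Function.comp]
    linarith

/-- Integrated form of the transport inequality on a large compact interval of `(0, ∞)`, with the
boundary terms made arbitrarily small. -/
lemma exists_interval_entropy_le (hα : 1 / 2 ≤ α) (hlam : 0 < lam) {f f' : ℝ → ℝ}
    (hd : ∀ x, 0 < x → HasDerivAt f (f' x) x) (hpos : ∀ x, 0 < x → 0 < f x)
    (hi : IntegrableOn f (Ioi 0)) (hone : ∫ x in Ioi (0 : ℝ), f x = 1)
    (hK : IntegrableOn (fun x => x * (f' x - gammaScore α lam x * f x) ^ 2 / f x) (Ioi 0))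
    {ε : ℝ} (hε : 0 < ε) :
    ∃ a b, 0 < a ∧ a < ε ∧ ε⁻¹ < b ∧ a < b ∧
      ∫ x in a..b, f x * Real.log (f x / ProbabilityTheory.gammaPDFReal α lam x) ≤
        (∫ x in Ioi (0 : ℝ), x * (f' x - gammaScore α lam x * f x) ^ 2 / f x) / lam + 4 * ε := by
  have hα0 : 0 < α := by linarith
  set p := ProbabilityTheory.gammaPDFReal α lam with hp
  set K : ℝ → ℝ := fun x => x * (f' x - gammaScore α lam x * f x) ^ 2 / f x with hKdef
  have hppos : ∀ x, 0 < x → 0 < p x := fun x hx =>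
    ProbabilityTheory.gammaPDFReal_pos hα0 hlam hx
  have hpc : ContinuousOn p (Ioi 0) := continuousOn_gammaPDFReal α lam
  have hfc : ContinuousOn f (Ioi 0) := fun x hx => (hd x hx).continuousAt.continuousWithinAt
  obtain ⟨T, hT⟩ := exists_transport hfc hi hpos hone hpc (integrableOn_gammaPDFReal hα0 hlam)
    hppos (integral_gammaPDFReal hα0 hlam)
  obtain ⟨a, ha0, ha, hga⟩ := exists_lt_mul_lt_of_integrableOn_Ioi hi hε (lt_min hε one_pos)
  have hM : 0 < max ε⁻¹ 1 := by positivity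
  -- Applied to `f + T f`, so that `b f(b)` and `b T(b) f(b)` are small together; the bounds by `1`
  -- on `a` and `b` ensure `a < 1 < b`.
  obtain ⟨b, hb, hgb⟩ := exists_gt_mul_lt_of_integrableOn_Ioi
    ((hi.mono_set (Ioi_subset_Ioi hM.le)).add (integrableOn_mul_transport hfc
      (fun x hx => (hpos x hx).le) hpc hppos (integrableOn_id_mul_gammaPDFReal hα0 hlam) hT hM))
    hM hε
  rw [lt_min_iff] at ha
  rw [max_lt_iff] at hb
  have hab : a < b := ha.2.trans hb.2
  refine ⟨a, b, ha0, ha.1, hb.1, hab, ?_⟩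
  have hb0 : 0 < b := ha0.trans hab
  have hsub : Icc a b ⊆ Ioi 0 := fun x hx => ha0.trans_le hx.1
  have hdΦ : ∀ x, 0 < x → HasDerivAt (fun x => 2 * (f x * (√(x * T x) - x)))
      (2 * (f' x * (√(x * T x) - x) +
        f x * ((T x + x * (f x / p (T x))) / (2 * √(x * T x)) - 1))) x := fun x hx => by
    have hxT : x * T x ≠ 0 := (mul_pos hx (hT x hx).1).ne'
    have h1 := (((hasDerivAt_id x).mul (hT x hx).2).sqrt hxT).sub (hasDerivAt_id x)
    refine (((hd x hx).mul h1).const_mul 2).congr_deriv ?_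
    simp
  have hlogc : ContinuousOn (fun x => f x * Real.log (f x / p x)) (Icc a b) :=
    (hfc.mono hsub).mul (((hfc.mono hsub).div (hpc.mono hsub) fun x hx => (hppos x (hsub hx)).ne').log
      fun x hx => (div_pos (hpos x (hsub hx)) (hppos x (hsub hx))).ne')
  have hKab := (hK.mono_set hsub).div_const lam
  -- `f'` need not be integrable on `[a, b]`; this one-sided form only needs an integrable lower
  -- bound for the derivative.
  have key := intervalIntegral.integral_le_sub_of_hasDeriv_right_of_le hab.le
    (fun x hx => (hdΦ x (hsub hx)).continuousAt.continuousWithinAt)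
    (fun x hx => (hdΦ x (ha0.trans hx.1)).hasDerivWithinAt)
    (hlogc.integrableOn_Icc.sub hKab) (fun x hx => by
      have hx0 := ha0.trans hx.1
      have := entropy_density_le (D := f' x) hα hlam hx0 (hT x hx0).1 (hpos x hx0)
      simp only [Pi.sub_apply]
      linarith)
  have hKii : IntervalIntegrable (fun x => K x / lam) volume a b := by
    rw [intervalIntegrable_iff_integrableOn_Icc_of_le hab.le]
    exact hKab
  simp only [Pi.sub_apply] at key
  rw [intervalIntegral.integral_sub
    (hlogc.intervalIntegrable_of_Icc hab.le) hKii, intervalIntegral.integral_div] at key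
  have hKle : ∫ x in a..b, K x ≤ ∫ x in Ioi (0 : ℝ), K x := by
    rw [intervalIntegral.integral_of_le hab.le]
    refine setIntegral_mono_set hK ((ae_restrict_iff' measurableSet_Ioi).2 (ae_of_all _ ?_))
      (Ioc_subset_Icc_self.trans hsub).eventuallyLE
    intro x hx
    have hx : 0 < x := hx
    have := hpos x hx
    simp only [hKdef, Pi.zero_apply]
    positivity
  have hKle' := div_le_div_of_nonneg_right hKle hlam.le
  have hΦb : f b * (√(b * T b) - b) ≤ ε := by
    have hfb := hpos b hb0
    have hTb := (hT b hb0).1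
    have : √(b * T b) ≤ b * (1 + T b) := by
      rw [Real.sqrt_le_left (by positivity)]
      nlinarith [mul_pos hb0 hTb, sq_nonneg (b * T b), mul_pos (mul_pos hb0 hTb) (sub_pos.2 hb.2)]
    simp only [Pi.add_apply] at hgb
    have := mul_le_mul_of_nonneg_left this hfb.le
    nlinarith
  have hΦa : -ε ≤ f a * (√(a * T a) - a) := by
    have := mul_nonneg (hpos a ha0).le (Real.sqrt_nonneg (a * T a))
    nlinarith
  linarith

/-- The logarithmic Sobolev inequality for the gamma law and an everywhere positive density. -/
lemma lintegral_klFun_le_of_pos (hα : 1 / 2 ≤ α) (hlam : 0 < lam) {f f' : ℝ → ℝ}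
    (hd : ∀ x, 0 < x → HasDerivAt f (f' x) x) (hpos : ∀ x, 0 < x → 0 < f x)
    (hi : IntegrableOn f (Ioi 0)) (hone : ∫ x in Ioi (0 : ℝ), f x = 1)
    (hK : IntegrableOn (fun x => x * (f' x - gammaScore α lam x * f x) ^ 2 / f x) (Ioi 0)) :
    ∫⁻ x in Ioi (0 : ℝ), ENNReal.ofReal (ProbabilityTheory.gammaPDFReal α lam x *
        InformationTheory.klFun (f x / ProbabilityTheory.gammaPDFReal α lam x)) ≤
      ENNReal.ofReal
        ((∫ x in Ioi (0 : ℝ), x * (f' x - gammaScore α lam x * f x) ^ 2 / f x) / lam) := by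
  have hα0 : 0 < α := by linarith
  have hpi := integrableOn_gammaPDFReal hα0 hlam
  have hp1 := integral_gammaPDFReal hα0 hlam
  set p := ProbabilityTheory.gammaPDFReal α lam with hp
  have hppos : ∀ x, 0 < x → 0 < p x := fun x hx =>
    ProbabilityTheory.gammaPDFReal_pos hα0 hlam hx
  have hpc : ContinuousOn p (Ioi 0) := continuousOn_gammaPDFReal α lam
  have hfc : ContinuousOn f (Ioi 0) := fun x hx => (hd x hx).continuousAt.continuousWithinAt
  have hkc : ContinuousOn (fun x => p x * InformationTheory.klFun (f x / p x)) (Ioi 0) :=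
    hpc.mul (InformationTheory.continuous_klFun.comp_continuousOn
      (hfc.div hpc fun x hx => (hppos x hx).ne'))
  have hknn : ∀ x, 0 < x → 0 ≤ p x * InformationTheory.klFun (f x / p x) := fun x hx =>
    mul_nonneg (hppos x hx).le
      (InformationTheory.klFun_nonneg (div_pos (hpos x hx) (hppos x hx)).le)
  choose a b ha0 ha hb hab hle using fun n : ℕ =>
    exists_interval_entropy_le hα hlam hd hpos hi hone hK (Nat.one_div_pos_of_nat (α := ℝ) (n := n))
  have hε := tendsto_one_div_add_atTop_nhds_zero_nat (𝕜 := ℝ)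
  have hat : Tendsto a atTop (𝓝 0) := squeeze_zero (fun n => (ha0 n).le) (fun n => (ha n).le) hε
  have hbt : Tendsto b atTop atTop := by
    refine tendsto_atTop_mono (fun n => (hb n).le) ?_
    simp only [one_div, inv_inv]
    exact tendsto_atTop_add_const_right _ _ tendsto_natCast_atTop_atTop
  have hcov : AECover (volume.restrict (Ioi (0 : ℝ))) atTop fun n => Ioc (a n) (b n) :=
    (aecover_Ioi_of_Ioi hat).inter ((aecover_Iic hbt).mono Measure.restrict_le_self)
  have hl := hcov.lintegral_tendsto_of_countably_generated
    (f := fun x => ENNReal.ofReal (p x * InformationTheory.klFun (f x / p x)))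
    (hkc.aemeasurable measurableSet_Ioi).ennreal_ofReal
  -- `p * klFun (f / p) = (p - f) + f log (f / p)`; the correction `p - f` integrates to zero only
  -- in the limit.
  have hr := hcov.integral_tendsto_of_countably_generated (hpi.sub hi)
  simp only [Pi.sub_apply] at hr
  rw [integral_sub hpi hi, hp1, hone, sub_self] at hr
  have hrhs := ((hr.add_const
    ((∫ x in Ioi (0 : ℝ), x * (f' x - gammaScore α lam x * f x) ^ 2 / f x) / lam)).add
      (hε.const_mul 4))
  rw [zero_add, mul_zero, add_zero] at hrhs
  refine le_of_tendsto_of_tendsto' hl ((ENNReal.continuous_ofReal.tendsto _).comp hrhs) fun n => ?_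
  have hsub : Icc (a n) (b n) ⊆ Ioi 0 := fun x hx => (ha0 n).trans_le hx.1
  have hsub' : Ioc (a n) (b n) ⊆ Ioi 0 := Ioc_subset_Icc_self.trans hsub
  have hkint : IntegrableOn (fun x => p x * InformationTheory.klFun (f x / p x))
      (Ioc (a n) (b n)) := (hkc.mono hsub).integrableOn_Icc.mono_set Ioc_subset_Icc_self
  simp only [Measure.restrict_restrict measurableSet_Ioc, inter_eq_left.2 hsub', Function.comp]
  rw [← ofReal_integral_eq_lintegral_ofReal hkint
    ((ae_restrict_iff' measurableSet_Ioc).2 (ae_of_all _ fun x hx => hknn x (hsub' hx)))]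
  refine ENNReal.ofReal_le_ofReal ?_
  have hsplit : ∫ x in Ioc (a n) (b n), p x * InformationTheory.klFun (f x / p x) =
      (∫ x in Ioc (a n) (b n), (p x - f x)) +
        ∫ x in Ioc (a n) (b n), f x * Real.log (f x / p x) := by
    have hlog : IntegrableOn (fun x => f x * Real.log (f x / p x)) (Ioc (a n) (b n)) := by
      refine IntegrableOn.mono_set (t := Icc (a n) (b n)) ?_ Ioc_subset_Icc_self
      refine ContinuousOn.integrableOn_Icc ?_
      exact (hfc.mono hsub).mul (((hfc.mono hsub).div (hpc.mono hsub)
        fun x hx => (hppos x (hsub hx)).ne').log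
        fun x hx => (div_pos (hpos x (hsub hx)) (hppos x (hsub hx))).ne')
    have hpf : IntegrableOn (fun x => p x - f x) (Ioc (a n) (b n)) := (hpi.sub hi).mono_set hsub'
    rw [← integral_add hpf hlog]
    refine setIntegral_congr_fun measurableSet_Ioc fun x hx => ?_
    have := (hppos x (hsub' hx)).ne'
    simp only [InformationTheory.klFun_apply]
    field_simp
    ring
  have := hle n
  rw [intervalIntegral.integral_of_le (hab n).le] at this
  rw [hsplit]
  linarith

/-! ### Densities with zeros. -/

lemma measurable_gammaScore (α lam : ℝ) : Measurable (gammaScore α lam) := by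
  unfold gammaScore
  fun_prop

/-- Mixing a density with the gamma density does not increase the information density. -/
lemma information_density_mix_le {x s a d q t : ℝ} (hx : 0 < x) (ha : 0 ≤ a)
    (hd : a = 0 → d = 0) (hq : 0 < q) (ht0 : 0 < t) (ht1 : t < 1) :
    x * (((1 - t) * d + t * (s * q)) - s * ((1 - t) * a + t * q)) ^ 2 / ((1 - t) * a + t * q) ≤
      x * (d - s * a) ^ 2 / a := by
  have h1 : 0 < 1 - t := sub_pos.2 ht1
  rw [show ((1 - t) * d + t * (s * q)) - s * ((1 - t) * a + t * q) = (1 - t) * (d - s * a) by ring]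
  rcases ha.eq_or_lt with rfl | ha
  · simp [hd rfl]
  · rw [div_le_div_iff₀ (by positivity) ha]
    have h2 : 0 ≤ x * (d - s * a) ^ 2 := by positivity
    have h3 : (1 - t) ^ 2 * a ≤ (1 - t) * a + t * q := by
      nlinarith [mul_pos ht0 hq, mul_pos (mul_pos ht0 h1) ha]
    nlinarith [mul_le_mul_of_nonneg_left h3 h2]

/-- The logarithmic Sobolev inequality for the gamma law, in terms of densities. -/
lemma lintegral_klFun_le (hα : 1 / 2 ≤ α) (hlam : 0 < lam) {f : ℝ → ℝ}
    (hd : ∀ x, 0 < x → DifferentiableAt ℝ f x) (hnn : ∀ x, 0 < x → 0 ≤ f x)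
    (hi : IntegrableOn f (Ioi 0)) (hone : ∫ x in Ioi (0 : ℝ), f x = 1)
    (hK : IntegrableOn (fun x => x * (deriv f x - gammaScore α lam x * f x) ^ 2 / f x) (Ioi 0)) :
    ∫⁻ x in Ioi (0 : ℝ), ENNReal.ofReal (ProbabilityTheory.gammaPDFReal α lam x *
        InformationTheory.klFun (f x / ProbabilityTheory.gammaPDFReal α lam x)) ≤
      ENNReal.ofReal
        ((∫ x in Ioi (0 : ℝ), x * (deriv f x - gammaScore α lam x * f x) ^ 2 / f x) / lam) := by
  have hα0 : 0 < α := by linarith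
  have hpi := integrableOn_gammaPDFReal hα0 hlam
  have hp1 := integral_gammaPDFReal hα0 hlam
  have hpd := fun x (hx : 0 < x) => hasDerivAt_gammaPDFReal α lam hx
  have hpm := ProbabilityTheory.measurable_gammaPDFReal α lam
  have hppos : ∀ x, 0 < x → 0 < ProbabilityTheory.gammaPDFReal α lam x := fun x hx =>
    ProbabilityTheory.gammaPDFReal_pos hα0 hlam hx
  set p := ProbabilityTheory.gammaPDFReal α lam with hp
  have hfm : AEMeasurable f (volume.restrict (Ioi 0)) := hi.aemeasurable
  have hsm := measurable_gammaScore α lam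
  -- A zero of `f` is a minimum. The information density of the mixture then vanishes there,
  -- matching the value `0` of the division by `f x = 0`.
  have hd0 : ∀ x, 0 < x → f x = 0 → deriv f x = 0 := fun x hx hfx => by
    refine IsLocalMin.deriv_eq_zero ?_
    filter_upwards [Ioi_mem_nhds hx] with y hy
    rw [hfx]
    exact hnn y hy
  have hbound : ∀ t : ℝ, 0 < t → t < 1 →
      ∫⁻ x in Ioi (0 : ℝ), ENNReal.ofReal
        (p x * InformationTheory.klFun (((1 - t) * f x + t * p x) / p x)) ≤
      ENNReal.ofReal
        ((∫ x in Ioi (0 : ℝ), x * (deriv f x - gammaScore α lam x * f x) ^ 2 / f x) / lam) := by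
    intro t ht0 ht1
    have h1t : 0 < 1 - t := sub_pos.2 ht1
    have hpos : ∀ x, 0 < x → 0 < (1 - t) * f x + t * p x := fun x hx =>
      add_pos_of_nonneg_of_pos (mul_nonneg h1t.le (hnn x hx)) (mul_pos ht0 (hppos x hx))
    have hmix : ∀ x, 0 < x → x * (((1 - t) * deriv f x + t * (gammaScore α lam x * p x)) -
        gammaScore α lam x * ((1 - t) * f x + t * p x)) ^ 2 / ((1 - t) * f x + t * p x) ≤
        x * (deriv f x - gammaScore α lam x * f x) ^ 2 / f x := fun x hx =>
      information_density_mix_le hx (hnn x hx) (hd0 x hx) (hppos x hx) ht0 ht1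
    have hKt : IntegrableOn (fun x => x * (((1 - t) * deriv f x + t * (gammaScore α lam x * p x)) -
        gammaScore α lam x * ((1 - t) * f x + t * p x)) ^ 2 / ((1 - t) * f x + t * p x))
        (Ioi 0) := by
      refine Integrable.mono' hK ?_
        ((ae_restrict_iff' measurableSet_Ioi).2 (ae_of_all _ fun x hx => ?_))
      · have hdm := measurable_deriv f
        exact AEMeasurable.aestronglyMeasurable (by fun_prop)
      · have hx : 0 < x := hx
        have := hpos x hx
        rw [Real.norm_of_nonneg (by positivity)]
        exact hmix x hx
    refine (lintegral_klFun_le_of_pos hα hlam (f := fun x => (1 - t) * f x + t * p x)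
      (f' := fun x => (1 - t) * deriv f x + t * (gammaScore α lam x * p x))
      (fun x hx => ((hd x hx).hasDerivAt.const_mul _).add ((hpd x hx).const_mul _)) hpos
      ((hi.const_mul _).add (hpi.const_mul _)) ?_ hKt).trans ?_
    · rw [integral_add (hi.const_mul _) (hpi.const_mul _), integral_const_mul, integral_const_mul,
        hone, hp1]
      ring
    · exact ENNReal.ofReal_le_ofReal (div_le_div_of_nonneg_right
        (setIntegral_mono_on hKt hK measurableSet_Ioi hmix) hlam.le)
  have hlim : ∀ x, Tendsto (fun n : ℕ => ENNReal.ofReal (p x * InformationTheory.klFun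
      (((1 - 1 / ((n : ℝ) + 2)) * f x + 1 / ((n : ℝ) + 2) * p x) / p x))) atTop
      (𝓝 (ENNReal.ofReal (p x * InformationTheory.klFun (f x / p x)))) := fun x => by
    -- The shift by `2` keeps the mixing weight strictly below `1` for every `n`.
    have ht : Tendsto (fun n : ℕ => 1 / ((n : ℝ) + 2)) atTop (𝓝 0) := by
      simp only [one_div]
      exact tendsto_inv_atTop_zero.comp
        (tendsto_atTop_add_const_right _ _ tendsto_natCast_atTop_atTop)
    have hc : Continuous fun t : ℝ => ENNReal.ofReal (p x * InformationTheory.klFun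
        (((1 - t) * f x + t * p x) / p x)) := by
      have := InformationTheory.continuous_klFun
      exact ENNReal.continuous_ofReal.comp (by fun_prop)
    have h := (hc.tendsto 0).comp ht
    rw [sub_zero, one_mul, zero_mul, add_zero] at h
    exact h
  calc _ = ∫⁻ x in Ioi (0 : ℝ), liminf (fun n : ℕ => ENNReal.ofReal (p x *
        InformationTheory.klFun
          (((1 - 1 / ((n : ℝ) + 2)) * f x + 1 / ((n : ℝ) + 2) * p x) / p x))) atTop :=
        lintegral_congr fun x => (hlim x).liminf_eq.symm
    _ ≤ _ := lintegral_liminf_le' fun n => by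
        have := InformationTheory.measurable_klFun
        fun_prop
    _ ≤ _ := liminf_le_of_frequently_le' (Frequently.of_forall fun n => hbound _ (by positivity) (by
        rw [div_lt_one (by positivity)]
        have : (0 : ℝ) ≤ n := n.cast_nonneg
        linarith))

/-! ### From the random variable to its density. -/

lemma gammaMeasure_eq_withDensity_restrict (α lam : ℝ) :
    ProbabilityTheory.gammaMeasure α lam =
      (volume.restrict (Ioi (0 : ℝ))).withDensity (ProbabilityTheory.gammaPDF α lam) := by
  rw [ProbabilityTheory.gammaMeasure, ← withDensity_indicator measurableSet_Ioi]
  refine withDensity_congr_ae ?_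
  -- The origin is discarded because `gammaPDF` uses the closed half-line and may be nonzero at `0`.
  filter_upwards [compl_mem_ae_iff.2 (measure_singleton (0 : ℝ))] with x hx
  have hx : x ≠ 0 := hx
  by_cases h : 0 < x
  · rw [indicator_of_mem (show x ∈ Ioi 0 from h)]
  · rw [indicator_of_notMem (show x ∉ Ioi 0 from h)]
    exact ProbabilityTheory.gammaPDF_of_neg (lt_of_le_of_ne (not_lt.1 h) hx)

/-- The relative entropy of a density with respect to the gamma law. -/
lemma klDiv_gammaMeasure_eq_lintegral (hα : 0 < α) (hlam : 0 < lam) {f : ℝ → ℝ}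
    (hfm : AEMeasurable f (volume.restrict (Ioi 0))) (hnn : ∀ x, 0 < x → 0 ≤ f x) {μ : Measure ℝ}
    [IsFiniteMeasure μ]
    (hμ : μ = (volume.restrict (Ioi (0 : ℝ))).withDensity (fun u => ENNReal.ofReal (f u))) :
    InformationTheory.klDiv μ (ProbabilityTheory.gammaMeasure α lam) =
      ∫⁻ x in Ioi (0 : ℝ), ENNReal.ofReal (ProbabilityTheory.gammaPDFReal α lam x *
        InformationTheory.klFun (f x / ProbabilityTheory.gammaPDFReal α lam x)) := by
  have := ProbabilityTheory.isProbabilityMeasure_gammaMeasure hα hlam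
  have hpm := ProbabilityTheory.measurable_gammaPDFReal α lam
  have hppos : ∀ x, 0 < x → 0 < ProbabilityTheory.gammaPDFReal α lam x := fun x hx =>
    ProbabilityTheory.gammaPDFReal_pos hα hlam hx
  have hν := gammaMeasure_eq_withDensity_restrict α lam
  have hPm : Measurable (ProbabilityTheory.gammaPDF α lam) := hpm.ennreal_ofReal
  have hhm : AEMeasurable
      (fun x => ENNReal.ofReal (f x / ProbabilityTheory.gammaPDFReal α lam x))
      (volume.restrict (Ioi 0)) := by fun_prop
  have hac : ProbabilityTheory.gammaMeasure α lam ≪ volume.restrict (Ioi (0 : ℝ)) := by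
    rw [hν]
    exact withDensity_absolutelyContinuous _ _
  have hμν : μ = (ProbabilityTheory.gammaMeasure α lam).withDensity
      (fun x => ENNReal.ofReal (f x / ProbabilityTheory.gammaPDFReal α lam x)) := by
    rw [hμ, hν, ← withDensity_mul₀ hPm.aemeasurable hhm]
    refine withDensity_congr_ae
      ((ae_restrict_iff' measurableSet_Ioi).2 (ae_of_all _ fun x hx => ?_))
    have hpx := hppos x hx
    simp only [Pi.mul_apply, ProbabilityTheory.gammaPDF]
    rw [← ENNReal.ofReal_mul hpx.le, mul_div_cancel₀ _ hpx.ne']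
  have hμac : μ ≪ ProbabilityTheory.gammaMeasure α lam := by
    rw [hμν]
    exact withDensity_absolutelyContinuous _ _
  have hrn : μ.rnDeriv (ProbabilityTheory.gammaMeasure α lam)
      =ᵐ[ProbabilityTheory.gammaMeasure α lam]
      fun x => ENNReal.ofReal (f x / ProbabilityTheory.gammaPDFReal α lam x) := by
    rw [hμν]
    exact Measure.rnDeriv_withDensity₀ _ (hhm.mono_ac hac)
  rw [InformationTheory.klDiv_eq_lintegral_klFun_of_ac hμac]
  calc _ = ∫⁻ x, ENNReal.ofReal (InformationTheory.klFun
        (ENNReal.ofReal (f x / ProbabilityTheory.gammaPDFReal α lam x)).toReal)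
        ∂ProbabilityTheory.gammaMeasure α lam := by
        refine lintegral_congr_ae ?_
        filter_upwards [hrn] with x hx
        rw [hx]
    _ = _ := by
        have := InformationTheory.measurable_klFun
        rw [hν, lintegral_withDensity_eq_lintegral_mul₀ hPm.aemeasurable (by fun_prop)]
        refine setLIntegral_congr_fun measurableSet_Ioi fun x hx => ?_
        have hpx := hppos x hx
        simp only [Pi.mul_apply, ProbabilityTheory.gammaPDF]
        rw [← ENNReal.ofReal_mul hpx.le, ENNReal.toReal_ofReal (div_nonneg (hnn x hx) hpx.le)]

/-- The standardized Fisher information in terms of the density. -/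
lemma stdGammaFisher_eq_lintegral {Ω : Type*} [MeasurableSpace Ω] {P : Measure Ω}
    {X : Ω → ℝ} (hX : AEMeasurable X P) {f : ℝ → ℝ} (hd : ∀ x, 0 < x → DifferentiableAt ℝ f x)
    (hnn : ∀ x, 0 < x → 0 ≤ f x) (hfm : AEMeasurable f (volume.restrict (Ioi 0)))
    (hμ : P.map X = (volume.restrict (Ioi (0 : ℝ))).withDensity (fun u => ENNReal.ofReal (f u))) :
    stdGammaFisher P X f α lam = ∫⁻ x in Ioi (0 : ℝ),
      ENNReal.ofReal (x * (deriv f x - gammaScore α lam x * f x) ^ 2 / f x) := by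
  have hsm := measurable_gammaScore α lam
  have hscm : Measurable (score f) := measurable_deriv _
  have hm : Measurable fun x => ENNReal.ofReal (x * (score f x - gammaScore α lam x) ^ 2) := by
    fun_prop
  rw [stdGammaFisher, ← lintegral_map' (f := fun x => ENNReal.ofReal
    (x * (score f x - gammaScore α lam x) ^ 2)) hm.aemeasurable hX, hμ,
    lintegral_withDensity_eq_lintegral_mul₀ hfm.ennreal_ofReal hm.aemeasurable]
  refine setLIntegral_congr_fun measurableSet_Ioi fun x hx => ?_
  have hx : 0 < x := hx
  simp only [Pi.mul_apply]
  rw [← ENNReal.ofReal_mul (hnn x hx)]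
  congr 1
  -- Where `f x = 0` both sides are `0`: the left through the weight `f x`, the right through
  -- division by zero.
  rcases (hnn x hx).eq_or_lt with h | h
  · simp [← h]
  · have hs : score f x = deriv f x / f x := ((hd x hx).hasDerivAt.log h.ne').deriv
    rw [hs]
    field_simp

end GammaLogSobolev

theorem mainTheorem4 {Ω : Type*} [MeasurableSpace Ω] (P : Measure Ω) [IsProbabilityMeasure P]
    (α lam : ℝ) (hα : 1 / 2 ≤ α) (hlam : 0 < lam)
    (X : Ω → ℝ) (hX : AEMeasurable X P)
    (f : ℝ → ℝ) (hf_nonneg : ∀ u ∈ Ioi (0 : ℝ), 0 ≤ f u)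
    (hf_smooth : DifferentiableOn ℝ f (Ioi 0))
    (hf_density : P.map X =
      (volume.restrict (Ioi (0 : ℝ))).withDensity (fun u => ENNReal.ofReal (f u)))
    (hJ : stdGammaFisher P X f α lam < ⊤) :
    InformationTheory.klDiv (P.map X) (ProbabilityTheory.gammaMeasure α lam)
      ≤ stdGammaFisher P X f α lam / ENNReal.ofReal lam := by
  have hα0 : 0 < α := by linarith
  have hd : ∀ x, 0 < x → DifferentiableAt ℝ f x := fun x hx =>
    hf_smooth.differentiableAt (Ioi_mem_nhds hx)
  have hfm : AEMeasurable f (volume.restrict (Ioi 0)) :=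
    hf_smooth.continuousOn.aemeasurable measurableSet_Ioi
  have hfnn : 0 ≤ᵐ[volume.restrict (Ioi 0)] f :=
    (ae_restrict_iff' measurableSet_Ioi).2 (ae_of_all _ hf_nonneg)
  have hprob : IsProbabilityMeasure (P.map X) := Measure.isProbabilityMeasure_map hX
  have hmass : ∫⁻ x in Ioi (0 : ℝ), ENNReal.ofReal (f x) = 1 := by
    have := hprob.measure_univ
    rwa [hf_density, withDensity_apply _ MeasurableSet.univ, Measure.restrict_univ] at this
  have hi : IntegrableOn f (Ioi 0) := by
    refine ⟨hfm.aestronglyMeasurable, ?_⟩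
    rw [hasFiniteIntegral_iff_ofReal hfnn, hmass]
    exact ENNReal.one_lt_top
  have hone : ∫ x in Ioi (0 : ℝ), f x = 1 := by
    rw [integral_eq_lintegral_of_nonneg_ae hfnn hfm.aestronglyMeasurable, hmass,
      ENNReal.toReal_one]
  have hKnn : 0 ≤ᵐ[volume.restrict (Ioi 0)]
      fun x => x * (deriv f x - gammaScore α lam x * f x) ^ 2 / f x := by
    refine (ae_restrict_iff' measurableSet_Ioi).2 (ae_of_all _ fun x hx => ?_)
    exact div_nonneg (mul_nonneg (le_of_lt hx) (sq_nonneg _)) (hf_nonneg x hx)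
  have hsm := measurable_gammaScore α lam
  have hdm := measurable_deriv f
  have hKm : AEMeasurable (fun x => x * (deriv f x - gammaScore α lam x * f x) ^ 2 / f x)
      (volume.restrict (Ioi 0)) := by fun_prop
  rw [stdGammaFisher_eq_lintegral hX hd hf_nonneg hfm hf_density] at hJ ⊢
  have hK : IntegrableOn (fun x => x * (deriv f x - gammaScore α lam x * f x) ^ 2 / f x)
      (Ioi 0) :=
    ⟨hKm.aestronglyMeasurable, (hasFiniteIntegral_iff_ofReal hKnn).2 hJ⟩
  rw [klDiv_gammaMeasure_eq_lintegral hα0 hlam hfm hf_nonneg hf_density,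
    ← ofReal_integral_eq_lintegral_ofReal hK hKnn, ← ENNReal.ofReal_div_of_pos hlam]
  exact lintegral_klFun_le hα hlam hd hf_nonneg hi hone hK
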